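/- Let $n\ge 1$, and let $\mathrm{Sp}(2n,\mathbb F_2)$ be the group of $2n\times 2n$ matrices $M$ over $\mathbb F_2$ with $M^{\mathsf T}\Omega M=\Omega$, $\Omega=\begin{bmatrix}0&I_n\\ I_n&0\end{bmatrix}$. Vectors $v\in\mathbb F_2^{2n}$ label the $n$-fold tensor products of Bell states: $(v_i,v_{n+i})=(0,0),(1,0),(1,1),(0,1)$ stands for $I,X,Y,Z$ (that is, $\Phi^+,\Psi^+,\Psi^-,\Phi^-$) on the $i$-th pair. A Bell-diagonal state of $n$ qubit pairs is given by a probability distribution $p$ on $\mathbb F_2^{2n}$. A bilocal Clifford operation is described by $M\in\mathrm{Sp}(2n,\mathbb F_2)$ and transforms $p$ into $\tilde p_v=p_{M^{-1}v}$. Let $$\mathscr B=\{v: v_i=0\ \text{for } 1\le i\le n+1\},\qquad \mathscr P=\{v: v_i=0\ \text{for } 2\le i\le n\}.$$ The bilocal Clifford protocol of $M$ applies $M$ and then measures the pairs $2,\dots,n$, keeping the first pair if all outcomes are correlated. Its distillation statistics on the input $p$ are the success probability $p_{\mathrm{suc}}=\sum_{v\in\mathscr P}\tilde p_v$, the fidelity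 $F=\frac1{p_{\mathrm{suc}}}\sum_{v\in\mathscr B}\tilde p_v$ and, up to permutation, the three other coefficients of the output state, $F_i=\frac1{p_{\mathrm{suc}}}\sum_{v\in\mathscr B+v_i}\tilde p_v$ with $v_1=e_1$, $v_2=e_1+e_{n+1}$, $v_3=e_{n+1}$ (if $p_{\mathrm{suc}}=0$, only $p_{\mathrm{suc}}$ matters). The distillation subgroup $\mathcal D_n\le\mathrm{Sp}(2n,\mathbb F_2)$ consists of the operations that preserve the distillation statistics of every Bell-diagonal state: for every $p$, the statistics computed from $\tilde p_v=p_{M^{-1}v}$ equal those computed with $\tilde p=p$. Then $$[\mathrm{Sp}(2n,\mathbb F_2):\mathcal D_n]=\frac13\,(2^n-1)\prod_{j=1}^n(2^j+1).$$ This is also the number of distinct bilocal Clifford protocols for general Bell-diagonal inputs, that is, the number of classes of $M\in\mathrm{Sp}(2n,\mathbb F_2)$ when two elements are identified if they give the same distillation statistics for every input. The number is the same whether the inputs are all Bell-diagonal states of $n$ pairs or only the tensor products $\rho_1\otimes\cdots\otimes\rho_n$ of $n$ Bell-diagonal two-qubit states. -/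

import Mathlib

namespace BilocalClifford

/-- The symplectic group `Sp(2n, 𝔽₂)`: the `2n × 2n` matrices over `𝔽₂` that preserve the standard
symplectic form. Rows and columns are indexed by `Fin n ⊕ Fin n`; `Sum.inl i` is the `X`-coordinate
and `Sum.inr i` the `Z`-coordinate of the `i`-th qubit (qubits are numbered from `0`). -/
abbrev Sp (n : ℕ) : Type := Matrix.symplecticGroup (Fin n) (ZMod 2)

/-- Binary vectors in `𝔽₂²ⁿ`; they stand for the `n`-qubit Pauli strings without phases, that is, for
the `n`-fold tensor products of Bell states: per qubit, `(0,0) ↦ I ↔ Φ⁺`, `(1,0) ↦ X ↔ Ψ⁺`,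
`(1,1) ↦ Y ↔ Ψ⁻`, `(0,1) ↦ Z ↔ Φ⁻`. -/
abbrev BinVec (n : ℕ) : Type := Fin n ⊕ Fin n → ZMod 2

/-- A Bell-diagonal state of `n` qubit pairs, given by the probability `p v` of each of the
`4ⁿ` tensor products of Bell states. -/
abbrev BellDiagonal (n : ℕ) : Type := stdSimplex ℝ (BinVec n)

/-- The Bell-diagonal states that are tensor products `ρ₁ ⊗ ⋯ ⊗ ρₙ` of `n` Bell-diagonal
two-qubit states; `q i` lists the four coefficients of the `i`-th pair. -/
def productStates (n : ℕ) : Set (BellDiagonal n) :=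
  {Q | ∃ q : Fin n → stdSimplex ℝ (ZMod 2 × ZMod 2),
    ∀ v : BinVec n, Q.1 v = ∏ i, (q i).1 (v (Sum.inl i), v (Sum.inr i))}

/-- The action of `M` on the probability vector `p` of a state: the Bell state with label `v` is
mapped to the one with label `M v`, so the new probabilities are `p̃ v = p (M⁻¹ v)`. -/
def evolve {n : ℕ} (M : Sp n) (Q : BellDiagonal n) : BellDiagonal n :=
  ⟨fun v => Q.1 ((M⁻¹ : Sp n).1.mulVec v), fun _ => Q.2.1 _, by
    have hb : Function.Bijective fun v : BinVec n => (M⁻¹ : Sp n).1.mulVec v := by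
      refine Function.bijective_iff_has_inverse.2 ⟨fun v => M.1.mulVec v, fun v => ?_, fun v => ?_⟩
      · have h : M.1 * (M⁻¹ : Sp n).1 = 1 := congrArg Subtype.val (mul_inv_cancel M)
        simp [Matrix.mulVec_mulVec, h]
      · have h : (M⁻¹ : Sp n).1 * M.1 = 1 := congrArg Subtype.val (inv_mul_cancel M)
        simp [Matrix.mulVec_mulVec, h]
    exact (hb.sum_comp Q.1).trans Q.2.2⟩

theorem evolve_one {n : ℕ} (Q : BellDiagonal n) : evolve 1 Q = Q := by
  apply Subtype.ext
  funext v
  simp [evolve]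

theorem evolve_mul {n : ℕ} (M N : Sp n) (Q : BellDiagonal n) :
    evolve (M * N) Q = evolve M (evolve N Q) := by
  apply Subtype.ext
  funext v
  simp only [evolve, mul_inv_rev]
  rw [Matrix.mulVec_mulVec]
  rfl

/-- The pillars: the labels whose `X`-coordinate vanishes on every qubit but the first. -/
def pillars (n : ℕ) [NeZero n] : Finset (BinVec n) :=
  {v | ∀ i : Fin n, i ≠ 0 → v (Sum.inl i) = 0}

/-- The base: the labels with all `X`-coordinates and the `Z`-coordinate of the first qubit zero. -/
def base (n : ℕ) [NeZero n] : Finset (BinVec n) :=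
  {v | (∀ i : Fin n, v (Sum.inl i) = 0) ∧ v (Sum.inr 0) = 0}

/-- The vector `x e₁ + z eₙ₊₁`: the single-qubit Pauli with coordinates `(x, z)` on the first
qubit. -/
def firstPauli (n : ℕ) [NeZero n] (x z : ZMod 2) : BinVec n :=
  Pi.single (Sum.inl 0) x + Pi.single (Sum.inr 0) z

/-- Probability that the outcomes of the measurements on the pairs `2, …, n` are all correlated. -/
noncomputable def successProb {n : ℕ} [NeZero n] (Q : BellDiagonal n) : ℝ :=
  ∑ v ∈ pillars n, Q.1 v

/-- Bell coefficient of the output pair at the Pauli `(x, z)`: the total probability of the coset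
`base + x e₁ + z eₙ₊₁`, divided by the success probability. If the protocol never succeeds there is
no output state, and the value is `0` by the convention `0 / 0 = 0`. -/
noncomputable def outputCoeff {n : ℕ} [NeZero n] (x z : ZMod 2) (Q : BellDiagonal n) : ℝ :=
  (∑ v ∈ base n, Q.1 (v + firstPauli n x z)) / successProb Q

/-- The distillation statistics: the success probability, the fidelity `F` (the `I`-coefficient of
the output), and the three other output coefficients (at `X`, `Y`, `Z`) up to permutation. -/
noncomputable def statistics {n : ℕ} [NeZero n] (Q : BellDiagonal n) : ℝ × ℝ × Multiset ℝ :=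
  (successProb Q, outputCoeff 0 0 Q, {outputCoeff 1 0 Q, outputCoeff 1 1 Q, outputCoeff 0 1 Q})

/-- The distillation subgroup `𝒟ₙ`: the operations that preserve the distillation statistics of
every Bell-diagonal state. -/
def distillationSubgroup (n : ℕ) [NeZero n] : Subgroup (Sp n) where
  carrier := {D | ∀ Q : BellDiagonal n, statistics (evolve D Q) = statistics Q}
  one_mem' := fun Q => by rw [evolve_one]
  mul_mem' := fun {D E} hD hE Q => by rw [evolve_mul, hD, hE]
  inv_mem' := fun {D} hD Q => by rw [← hD (evolve D⁻¹ Q), ← evolve_mul, mul_inv_cancel, evolve_one]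

/-- The number of distinct bilocal Clifford protocols for the inputs in `S`. The protocol of `M`
sends an input state to the distillation statistics obtained after `M` was applied, and protocols
are identified when they give the same statistics for every input in `S`. -/
noncomputable def numProtocols (n : ℕ) [NeZero n] (S : Set (BellDiagonal n)) : ℕ :=
  (Set.range fun (M : Sp n) (Q : S) => statistics (evolve M Q.1)).ncard

end BilocalClifford

namespace BilocalClifford

/-! The protocol of `M` sees its input only through `preBase M`, the preimage of the base under `M`.
The pillars are the symplectic complement of the base, so a symplectic map that preserves the base
preserves the pillars too, and it permutes the three nontrivial cosets of the base in the pillars;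
hence it preserves the statistics (`statistics_evolve`). Conversely, the fidelity on a single
product of Bell states reveals whether its label lies in `preBase M`. These test inputs are product
states, so restricting to product inputs identifies no further protocols (`statistics_eq_iff`). The
fibres of `preBase` are the right cosets of the distillation subgroup, so the index and both
protocol numbers equal the number of values of `preBase`.

The symplectic group is transitive on isotropic frames of length `n - 1`
(`exists_labelAction_comp_baseFrame`), so these values are exactly the isotropic subspaces of
dimension `n - 1`. Counting the frames and dividing by the number of bases of each subspace
(`card_range_preBase_mul`) gives a quotient of products that simplifies to the formula. -/

open Module

/-! ### Isotropic frames: counting them and completing them to symplectic families -/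

section Isotropic

variable {K V : Type*} [Field K] [AddCommGroup V] [Module K V] (ω : LinearMap.BilinForm K V)

/-- A linearly independent family of pairwise orthogonal isotropic vectors. -/
def IsotropicFrame {ι : Type*} (s : ι → V) : Prop :=
  LinearIndependent K s ∧ ∀ i j, ω (s i) (s j) = 0

variable {ω}

theorem mem_orthogonal_span_range {ι : Type*} {s : ι → V} {x : V} :
    x ∈ ω.orthogonal (Submodule.span K (Set.range s)) ↔ ∀ i, ω (s i) x = 0 := by
  constructor
  · intro h i
    exact h _ (Submodule.subset_span ⟨i, rfl⟩)
  · intro h y hy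
    induction hy using Submodule.span_induction with
    | mem y hy => obtain ⟨i, rfl⟩ := hy; exact h i
    | zero => simp
    | add y z _ _ hy hz => simp [hy, hz]
    | smul a y _ hy => simp [hy]

theorem IsotropicFrame.span_le_orthogonal {ι : Type*} {s : ι → V} (hs : IsotropicFrame ω s) :
    Submodule.span K (Set.range s) ≤ ω.orthogonal (Submodule.span K (Set.range s)) := by
  rw [Submodule.span_le]
  rintro _ ⟨j, rfl⟩
  exact mem_orthogonal_span_range.2 fun i => hs.2 i j

theorem isotropicFrame_snoc_iff (hω : ω.IsAlt) {k : ℕ} {s : Fin k → V} {x : V} :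
    IsotropicFrame ω (Fin.snoc s x : Fin (k + 1) → V) ↔
      IsotropicFrame ω s ∧ x ∈ ω.orthogonal (Submodule.span K (Set.range s)) ∧
        x ∉ Submodule.span K (Set.range s) := by
  rw [mem_orthogonal_span_range]
  simp only [IsotropicFrame, linearIndependent_finSnoc, Fin.forall_fin_succ', Fin.snoc_castSucc,
    Fin.snoc_last]
  constructor
  · rintro ⟨⟨h1, h2⟩, h3, -⟩
    exact ⟨⟨h1, fun i => (h3 i).1⟩, fun i => (h3 i).2, h2⟩
  · rintro ⟨⟨h1, h2⟩, h3, h4⟩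
    refine ⟨⟨h1, h4⟩, fun i => ⟨h2 i, h3 i⟩, fun i => ?_, hω.self_eq_zero x⟩
    rw [← hω.neg_eq, h3, neg_zero]

/-- An isotropic frame of length `k + 1` is one of length `k` together with a vector orthogonal to
its span and outside it. -/
def isotropicFrameSuccEquiv (hω : ω.IsAlt) (k : ℕ) :
    {s : Fin (k + 1) → V // IsotropicFrame ω s} ≃
      Σ s : {s : Fin k → V // IsotropicFrame ω s},
        {x : V // x ∈ ω.orthogonal (Submodule.span K (Set.range s.1)) ∧
          x ∉ Submodule.span K (Set.range s.1)} where
  toFun s :=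
    have h := (isotropicFrame_snoc_iff hω).1 ((Fin.snoc_init_self s.1).symm ▸ s.2)
    ⟨⟨Fin.init s.1, h.1⟩, ⟨s.1 (Fin.last k), h.2⟩⟩
  invFun t := ⟨Fin.snoc t.1.1 t.2.1, (isotropicFrame_snoc_iff hω).2 ⟨t.1.2, t.2.2⟩⟩
  left_inv s := by simp
  right_inv := by
    rintro ⟨⟨s, hs⟩, ⟨x, hx⟩⟩
    simp only [Sigma.mk.injEq, Fin.init_snoc, true_and]
    congr! <;> simp

/-- The span `W` has dimension `k` and lies in its orthogonal, whose dimension is `finrank K V - k`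
by nondegeneracy; the admissible vectors form the difference of the two. -/
theorem card_isotropic_extension [Finite K] [FiniteDimensional K V] (hnd : ω.Nondegenerate)
    {k : ℕ} {s : Fin k → V} (hs : IsotropicFrame ω s) :
    Nat.card {x : V // x ∈ ω.orthogonal (Submodule.span K (Set.range s)) ∧
      x ∉ Submodule.span K (Set.range s)} = Nat.card K ^ (finrank K V - k) - Nat.card K ^ k := by
  have : Finite V := Module.finite_of_finite K
  set W := Submodule.span K (Set.range s) with hW
  have hdim : finrank K W = k := by
    rw [hW, finrank_span_eq_card hs.1, Fintype.card_fin]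
  have h1 : Nat.card W = Nat.card K ^ k := by
    rw [Module.natCard_eq_pow_finrank (K := K), hdim]
  have h2 : Nat.card (ω.orthogonal W) = Nat.card K ^ (finrank K V - k) := by
    rw [Module.natCard_eq_pow_finrank (K := K), LinearMap.BilinForm.finrank_orthogonal hnd, hdim]
  rw [← h1, ← h2]
  have hsub : (W : Set V) ⊆ ω.orthogonal W := hs.span_le_orthogonal
  have := Set.ncard_sdiff hsub
  exact this

theorem card_isotropicFrame [Finite K] [FiniteDimensional K V] (hω : ω.IsAlt)
    (hnd : ω.Nondegenerate) (k : ℕ) :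
    Nat.card {s : Fin k → V // IsotropicFrame ω s} =
      ∏ i ∈ Finset.range k, (Nat.card K ^ (finrank K V - i) - Nat.card K ^ i) := by
  have : Finite V := Module.finite_of_finite K
  induction k with
  | zero =>
    have : Unique {s : Fin 0 → V // IsotropicFrame ω s} :=
      { default := ⟨Fin.elim0, linearIndependent_empty_type, fun i => i.elim0⟩
        uniq := fun _ => Subsingleton.elim _ _ }
    simp
  | succ k ih =>
    have := Fintype.ofFinite {s : Fin k → V // IsotropicFrame ω s}
    rw [Nat.card_congr (isotropicFrameSuccEquiv hω k), Nat.card_sigma,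
      Finset.sum_congr rfl fun s _ => card_isotropic_extension hnd s.2, Finset.sum_const,
      Finset.card_univ, ← Nat.card_eq_fintype_card, ih, Finset.prod_range_succ, smul_eq_mul]

theorem exists_dual_family [FiniteDimensional K V] (hnd : ω.Nondegenerate) {ι : Type*}
    [DecidableEq ι] {e : ι → V} (he : LinearIndependent K e) :
    ∃ f : ι → V, ∀ i j, ω (f j) (e i) = if i = j then 1 else 0 := by
  have key (j : ι) : ∃ x : V, ∀ i, ω x (e i) = if i = j then 1 else 0 := by
    obtain ⟨φ, hφ⟩ := LinearMap.exists_extend ((Finsupp.lapply j).comp he.repr)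
    refine ⟨(ω.toDual hnd).symm φ, fun i => ?_⟩
    rw [LinearMap.BilinForm.apply_toDual_symm_apply]
    have := LinearMap.congr_fun hφ ⟨e i, Submodule.subset_span ⟨i, rfl⟩⟩
    simp only [LinearMap.comp_apply, Submodule.subtype_apply, Finsupp.lapply_apply] at this
    rw [this]
    erw [he.repr_eq_single i _ rfl]
    simp [Finsupp.single_apply]
  choose f hf using key
  exact ⟨f, fun i j => hf j i⟩

/-- An isotropic frame is one half of a symplectic family. -/
theorem IsotropicFrame.exists_symplectic_partner [FiniteDimensional K V] (hω : ω.IsAlt)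
    (hnd : ω.Nondegenerate) {k : ℕ} {e : Fin k → V} (he : IsotropicFrame ω e) :
    ∃ f : Fin k → V, (∀ i j, ω (e i) (f j) = if i = j then 1 else 0) ∧
      ∀ i j, ω (f i) (f j) = 0 := by
  obtain ⟨g, hg⟩ := exists_dual_family hnd he.1
  have hf' (i j : Fin k) : ω (e i) (-g j) = if i = j then 1 else 0 := by
    rw [map_neg, hω.neg_eq, hg]
  obtain ⟨f, hf⟩ : ∃ f : Fin k → V, ∀ i j, ω (e i) (f j) = if i = j then 1 else 0 :=
    ⟨fun j => -g j, hf'⟩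
  have hf2 (i j : Fin k) : ω (f i) (e j) = if j = i then -1 else 0 := by
    rw [← hω.neg_eq, hf]
    split_ifs <;> simp
  -- Adding `∑ i, c i j • e i` to `f j` changes `ω (f i) (f j)` by `c j i - c i j` and leaves the
  -- pairing with `e` intact. Taking `c` strictly triangular avoids dividing by 2, which is
  -- essential in characteristic 2.
  let c (i j : Fin k) : K := if i < j then ω (f i) (f j) else 0
  refine ⟨fun j => f j + ∑ i, c i j • e i, fun i j => ?_, fun i j => ?_⟩
  · simp [map_sum, hf, he.2]
  · simp only [map_add, map_sum, map_smul, LinearMap.add_apply, LinearMap.sum_apply,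
      LinearMap.smul_apply, hf, hf2, he.2, smul_eq_mul, mul_ite, mul_one, mul_zero,
      Finset.sum_ite_eq', Finset.mem_univ, if_true, Finset.sum_const_zero]
    rcases lt_trichotomy i j with h | rfl | h
    · simp [c, h, h.not_gt]
    · simp [c, hω.self_eq_zero]
    · simp [c, h, h.not_gt, ← hω.neg_eq (f i) (f j)]

end Isotropic

/-! ### The symplectic form over `𝔽₂` and the action on labels -/

/-- The standard symplectic form on `𝔽₂²ⁿ`. -/
def symplecticForm (n : ℕ) : LinearMap.BilinForm (ZMod 2) (BinVec n) :=
  Matrix.toBilin' (Matrix.J (Fin n) (ZMod 2))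

theorem symplecticForm_eq_dotProduct {n : ℕ} (v w : BinVec n) :
    symplecticForm n v w = v ⬝ᵥ (Matrix.J (Fin n) (ZMod 2)).mulVec w :=
  Matrix.toBilin'_apply' _ _ _

theorem symplecticForm_apply {n : ℕ} (v w : BinVec n) :
    symplecticForm n v w =
      ∑ i, (v (Sum.inl i) * w (Sum.inr i) + v (Sum.inr i) * w (Sum.inl i)) := by
  rw [symplecticForm_eq_dotProduct]
  simp [dotProduct, Matrix.J, Matrix.mulVec, Finset.sum_add_distrib, ZMod.neg_eq_self_mod_two,
    Matrix.one_apply]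

theorem symplecticForm_isAlt (n : ℕ) : (symplecticForm n).IsAlt := by
  intro v
  rw [symplecticForm_apply]
  refine Finset.sum_eq_zero fun i _ => ?_
  rw [mul_comm, CharTwo.add_self_eq_zero]

theorem symplecticForm_nondegenerate (n : ℕ) : (symplecticForm n).Nondegenerate :=
  LinearMap.BilinForm.nondegenerate_toBilin'_of_det_ne_zero' _
    (Matrix.isUnit_det_J (Fin n) (ZMod 2)).ne_zero

theorem symplecticForm_single_inr {n : ℕ} (v : BinVec n) (i : Fin n) :
    symplecticForm n v (Pi.single (Sum.inr i) 1) = v (Sum.inl i) := by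
  simp [symplecticForm_apply, Pi.single_apply]

/-- The action of the symplectic group on labels. -/
def labelAction (n : ℕ) : Sp n →* (BinVec n ≃ₗ[ZMod 2] BinVec n) where
  toFun M := LinearEquiv.ofLinearMap (Matrix.toLin' M.1) (Matrix.toLin' (M⁻¹).1)
    (by rw [← Matrix.toLin'_mul, ← Submonoid.coe_mul, mul_inv_cancel]; simp)
    (by rw [← Matrix.toLin'_mul, ← Submonoid.coe_mul, inv_mul_cancel]; simp)
  map_one' := by ext; simp
  map_mul' M N := by
    apply LinearEquiv.ext
    intro v
    simp [Matrix.mulVec_mulVec]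

theorem labelAction_apply {n : ℕ} (M : Sp n) (v : BinVec n) :
    labelAction n M v = M.1.mulVec v := rfl

theorem labelAction_apply_inv_self {n : ℕ} (M : Sp n) (v : BinVec n) :
    labelAction n M (labelAction n M⁻¹ v) = v := by
  rw [← LinearEquiv.mul_apply, ← map_mul, mul_inv_cancel, map_one, LinearEquiv.coe_one, id]

theorem evolve_apply {n : ℕ} (M : Sp n) (Q : BellDiagonal n) (v : BinVec n) :
    (evolve M Q).1 v = Q.1 (labelAction n M⁻¹ v) := rfl

theorem symplecticForm_labelAction {n : ℕ} (M : Sp n) (v w : BinVec n) :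
    symplecticForm n (labelAction n M v) (labelAction n M w) = symplecticForm n v w := by
  simp only [symplecticForm_eq_dotProduct, labelAction_apply]
  rw [Matrix.dotProduct_mulVec, Matrix.vecMul_mulVec, ← Matrix.dotProduct_mulVec,
    Matrix.mulVec_mulVec, SymplecticGroup.mem_iff'.1 M.2]

theorem symplecticForm_apply_labelAction_inv {n : ℕ} (M : Sp n) (v w : BinVec n) :
    symplecticForm n v (labelAction n M⁻¹ w) = symplecticForm n (labelAction n M v) w := by
  rw [← symplecticForm_labelAction M, labelAction_apply_inv_self]

/-- A symplectic family of vectors consists of the columns of a symplectic matrix. -/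
theorem exists_labelAction_single {n : ℕ} {e f : Fin n → BinVec n}
    (hef : ∀ i j, symplecticForm n (e i) (f j) = if i = j then 1 else 0)
    (he : ∀ i j, symplecticForm n (e i) (e j) = 0)
    (hf : ∀ i j, symplecticForm n (f i) (f j) = 0) :
    ∃ M : Sp n, ∀ i, labelAction n M (Pi.single (Sum.inr i) 1) = e i := by
  let A : Matrix (Fin n ⊕ Fin n) (Fin n ⊕ Fin n) (ZMod 2) :=
    Matrix.of fun a b => Sum.elim f e b a
  have hA : A ∈ Matrix.symplecticGroup (Fin n) (ZMod 2) := by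
    rw [SymplecticGroup.mem_iff']
    have key (a b : Fin n ⊕ Fin n) : (A.transpose * Matrix.J (Fin n) (ZMod 2) * A) a b =
        symplecticForm n (Sum.elim f e a) (Sum.elim f e b) := by
      rw [symplecticForm_eq_dotProduct, Matrix.mul_assoc]
      rfl
    have hfe (i j : Fin n) : symplecticForm n (f i) (e j) = -if j = i then 1 else 0 := by
      rw [← (symplecticForm_isAlt n).neg_eq, hef]
    ext (i | i) (j | j) <;> rw [key] <;>
      simp [Matrix.J, hef, he, hf, hfe, Matrix.one_apply, eq_comm]
  refine ⟨⟨A, hA⟩, fun i => ?_⟩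
  rw [labelAction_apply, Matrix.mulVec_single_one]
  rfl

/-! ### The base and the pillars -/

section Base

variable (n : ℕ) [NeZero n]

/-- The base as a subspace. -/
def baseSubmodule : Submodule (ZMod 2) (BinVec n) where
  carrier := {v | (∀ i : Fin n, v (Sum.inl i) = 0) ∧ v (Sum.inr 0) = 0}
  add_mem' {v w} hv hw := ⟨fun i => by simp [hv.1 i, hw.1 i], by simp [hv.2, hw.2]⟩
  zero_mem' := ⟨fun _ => rfl, rfl⟩
  smul_mem' c v hv := ⟨fun i => by simp [hv.1 i], by simp [hv.2]⟩

variable {n}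

theorem mem_base {v : BinVec n} : v ∈ base n ↔ v ∈ baseSubmodule n := by
  simp [base, baseSubmodule]

theorem mem_pillars {v : BinVec n} :
    v ∈ pillars n ↔ ∀ i : Fin n, i ≠ 0 → v (Sum.inl i) = 0 := by
  simp [pillars]

theorem single_inr_mem_baseSubmodule {i : Fin n} (hi : i ≠ 0) :
    Pi.single (Sum.inr i) 1 ∈ baseSubmodule n :=
  ⟨fun j => by simp, by simp [hi.symm]⟩

theorem symplecticForm_eq_zero_of_mem {v w : BinVec n} (hv : v ∈ pillars n)
    (hw : w ∈ baseSubmodule n) : symplecticForm n v w = 0 := by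
  rw [symplecticForm_apply]
  refine Finset.sum_eq_zero fun i _ => ?_
  rw [hw.1 i, mul_zero, add_zero]
  by_cases hi : i = 0
  · rw [hi, hw.2, mul_zero]
  · rw [mem_pillars.1 hv i hi, zero_mul]

theorem firstPauli_mem_pillars (x z : ZMod 2) : firstPauli n x z ∈ pillars n := by
  rw [mem_pillars]
  intro i hi
  simp [firstPauli, hi]

theorem firstPauli_add (x z x' z' : ZMod 2) :
    firstPauli n (x + x') (z + z') = firstPauli n x z + firstPauli n x' z' := by
  simp only [firstPauli, Pi.single_add]
  abel

/-- Every pillar is, modulo the base, the Pauli on the first qubit with the same coordinates. -/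
theorem sub_firstPauli_mem {v : BinVec n} (hv : v ∈ pillars n) :
    v - firstPauli n (v (Sum.inl 0)) (v (Sum.inr 0)) ∈ baseSubmodule n := by
  refine ⟨fun i => ?_, by simp [firstPauli]⟩
  by_cases hi : i = 0
  · simp [firstPauli, hi]
  · simp [firstPauli, hi, mem_pillars.1 hv i hi]

theorem base_subset_pillars : base n ⊆ pillars n := by
  intro v hv
  rw [mem_pillars]
  exact fun i _ => (mem_base.1 hv).1 i

theorem labelAction_inv_mem_baseSubmodule {D : Sp n}
    (hD : ∀ v, labelAction n D v ∈ baseSubmodule n ↔ v ∈ baseSubmodule n) (v : BinVec n) :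
    labelAction n D⁻¹ v ∈ baseSubmodule n ↔ v ∈ baseSubmodule n := by
  rw [← hD, labelAction_apply_inv_self]

/-- Pillars are the labels orthogonal to the base, and `D` preserves both the form and the base. -/
theorem labelAction_mem_pillars {D : Sp n}
    (hD : ∀ v, labelAction n D v ∈ baseSubmodule n ↔ v ∈ baseSubmodule n) {v : BinVec n}
    (hv : v ∈ pillars n) : labelAction n D v ∈ pillars n := by
  rw [mem_pillars]
  intro i hi
  rw [← symplecticForm_single_inr (labelAction n D v), ← symplecticForm_apply_labelAction_inv]
  exact symplecticForm_eq_zero_of_mem hv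
    ((labelAction_inv_mem_baseSubmodule hD _).2 (single_inr_mem_baseSubmodule hi))

end Base
-- Statistics are classified by `preBase`
/-- The state that is a single tensor product of Bell states. -/
def pointState {n : ℕ} (v : BinVec n) : BellDiagonal n := ⟨Pi.single v 1, single_mem_stdSimplex ℝ v⟩

theorem pointState_mem_productStates {n : ℕ} (v : BinVec n) : pointState v ∈ productStates n := by
  refine ⟨fun i => ⟨Pi.single (v (Sum.inl i), v (Sum.inr i)) 1, single_mem_stdSimplex ℝ _⟩,
    fun w => ?_⟩
  simp only [pointState, Pi.single_apply, Prod.mk.injEq]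
  rw [Fintype.prod_ite_zero]
  simp only [Finset.prod_const_one]
  congr 1
  rw [funext_iff, Sum.forall, forall_and]

section Statistics

variable {n : ℕ} [NeZero n]

theorem sum_base_add_eq {w w' : BinVec n} (h : w - w' ∈ baseSubmodule n) (f : BinVec n → ℝ) :
    ∑ v ∈ base n, f (v + w) = ∑ v ∈ base n, f (v + w') := by
  refine Finset.sum_equiv (Equiv.addRight (w - w')) (fun v => ?_) fun v _ => ?_
  · rw [mem_base, mem_base, Equiv.coe_addRight, Submodule.add_mem_iff_left _ h]
  · congr 1
    simp only [Equiv.coe_addRight]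
    abel

theorem successProb_evolve {D : Sp n}
    (hD : ∀ v, labelAction n D v ∈ baseSubmodule n ↔ v ∈ baseSubmodule n) (Q : BellDiagonal n) :
    successProb (evolve D Q) = successProb Q := by
  refine Finset.sum_equiv (labelAction n D⁻¹).toEquiv (fun v => ?_) fun v _ => evolve_apply D Q v
  refine ⟨fun h => labelAction_mem_pillars (labelAction_inv_mem_baseSubmodule hD) h, fun h => ?_⟩
  rw [← labelAction_apply_inv_self D v]
  exact labelAction_mem_pillars hD h

theorem outputCoeff_evolve {D : Sp n}
    (hD : ∀ v, labelAction n D v ∈ baseSubmodule n ↔ v ∈ baseSubmodule n) (Q : BellDiagonal n)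
    (x z : ZMod 2) :
    outputCoeff x z (evolve D Q) =
      outputCoeff (labelAction n D⁻¹ (firstPauli n x z) (Sum.inl 0))
        (labelAction n D⁻¹ (firstPauli n x z) (Sum.inr 0)) Q := by
  have hD' := labelAction_inv_mem_baseSubmodule hD
  rw [outputCoeff, outputCoeff, successProb_evolve hD, ← sum_base_add_eq (sub_firstPauli_mem
    (labelAction_mem_pillars hD' (firstPauli_mem_pillars x z))) Q.1]
  congr 1
  refine Finset.sum_equiv (labelAction n D⁻¹).toEquiv (fun v => ?_) fun v _ => ?_
  · rw [mem_base, mem_base]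
    exact (hD' v).symm
  · rw [evolve_apply, map_add]
    rfl

theorem eq_zero_of_firstPauli_mem {x z : ZMod 2} (h : firstPauli n x z ∈ baseSubmodule n) :
    (x, z) = 0 := by
  have h1 := h.1 0
  have h2 := h.2
  simp only [firstPauli, Pi.add_apply, Pi.single_apply] at h1 h2
  simp_all

/-- The condition `a + b ≠ 0` says `a ≠ b`, so `a`, `a + b`, `b` exhaust the nonzero vectors of
`𝔽₂²`. This is why the output coefficients at `X`, `Y`, `Z` are only permuted. -/
theorem nonzero_pairs_eq : ∀ a b : ZMod 2 × ZMod 2, a ≠ 0 → b ≠ 0 → a + b ≠ 0 →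
    ({a, a + b, b} : Multiset (ZMod 2 × ZMod 2)) = {(1, 0), (1, 1), (0, 1)} := by
  decide

theorem statistics_evolve {D : Sp n}
    (hD : ∀ v, labelAction n D v ∈ baseSubmodule n ↔ v ∈ baseSubmodule n) (Q : BellDiagonal n) :
    statistics (evolve D Q) = statistics Q := by
  have hD' := labelAction_inv_mem_baseSubmodule hD
  let c (x z : ZMod 2) : ZMod 2 × ZMod 2 :=
    (labelAction n D⁻¹ (firstPauli n x z) (Sum.inl 0),
      labelAction n D⁻¹ (firstPauli n x z) (Sum.inr 0))
  let g (a : ZMod 2 × ZMod 2) : ℝ := outputCoeff a.1 a.2 Q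
  have hc (x z : ZMod 2) : outputCoeff x z (evolve D Q) = g (c x z) := outputCoeff_evolve hD Q x z
  have hadd : c 1 1 = c 1 0 + c 0 1 := by
    have : firstPauli n 1 1 = firstPauli n 1 0 + firstPauli n 0 1 := by
      rw [← firstPauli_add, add_zero, zero_add]
    simp only [c, this, map_add]
    rfl
  have hzero : firstPauli n 0 0 = 0 := by simp [firstPauli]
  -- The map induced on pillars modulo the base is injective, because `D⁻¹` pulls the base back to
  -- itself.
  have hne (x z : ZMod 2) (h : c x z = 0) : (x, z) = 0 := by
    apply eq_zero_of_firstPauli_mem (n := n)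
    rw [← hD']
    have := sub_firstPauli_mem (labelAction_mem_pillars hD' (firstPauli_mem_pillars x z))
    obtain ⟨h1, h2⟩ := Prod.ext_iff.1 h
    simp only [c, Prod.fst_zero, Prod.snd_zero] at h1 h2
    rwa [h1, h2, hzero, sub_zero] at this
  have h00 : c 0 0 = 0 := by
    simp only [c, hzero, map_zero]
    rfl
  have hms : ({g (c 1 0), g (c 1 1), g (c 0 1)} : Multiset ℝ) = {g (1, 0), g (1, 1), g (0, 1)} := by
    have := congrArg (Multiset.map g) (nonzero_pairs_eq (c 1 0) (c 0 1)
      (fun h => by simpa using hne _ _ h) (fun h => by simpa using hne _ _ h)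
      (fun h => by rw [← hadd] at h; simpa using hne _ _ h))
    rw [← hadd] at this
    simpa using this
  simp only [statistics, successProb_evolve hD, hc, h00, hms]
  rfl

/-- Off the pillars the quotient is `0 / 0 = 0`, the same value as on pillars outside the base, so
the fidelity is exactly the indicator of the base. -/
theorem outputCoeff_evolve_pointState (M : Sp n) (v : BinVec n) :
    outputCoeff 0 0 (evolve M (pointState v)) =
      if labelAction n M v ∈ base n then 1 else 0 := by
  have hQ (w : BinVec n) :
      (evolve M (pointState v)).1 w = if w = labelAction n M v then 1 else 0 := by
    simp only [evolve_apply, pointState, Pi.single_apply]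
    congr 1
    rw [eq_iff_iff, map_inv, LinearEquiv.coe_inv, LinearEquiv.symm_apply_eq]
  have hfp : firstPauli n 0 0 = 0 := by simp [firstPauli]
  simp only [outputCoeff, successProb, hfp, add_zero, hQ, Finset.sum_ite_eq']
  split_ifs with h1 h2
  · simp
  · exact absurd (base_subset_pillars h1) h2
  · simp
  · simp

/-- The labels that the protocol of `M` maps to the base. -/
def preBase (M : Sp n) : Submodule (ZMod 2) (BinVec n) :=
  (baseSubmodule n).comap (labelAction n M).toLinearMap

theorem mem_preBase {M : Sp n} {v : BinVec n} :
    v ∈ preBase M ↔ labelAction n M v ∈ baseSubmodule n := Iff.rfl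

theorem statistics_eq_iff {S : Set (BellDiagonal n)} (hS : productStates n ⊆ S) (M N : Sp n) :
    (∀ Q ∈ S, statistics (evolve M Q) = statistics (evolve N Q)) ↔ preBase M = preBase N := by
  constructor
  · intro h
    ext v
    have h1 := congrArg (fun s => s.2.1) (h _ (hS (pointState_mem_productStates v)))
    simp only [statistics, outputCoeff_evolve_pointState] at h1
    rw [mem_preBase, mem_preBase, ← mem_base, ← mem_base]
    split_ifs at h1 <;> simp_all
  · intro h Q _
    -- Write `M = (M * N⁻¹) * N`; equality of the preimages means that the left factor preserves the
    -- base.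
    have hD (v : BinVec n) : labelAction n (M * N⁻¹) v ∈ baseSubmodule n ↔
        v ∈ baseSubmodule n := by
      have := SetLike.ext_iff.1 h (labelAction n N⁻¹ v)
      rwa [mem_preBase, mem_preBase, labelAction_apply_inv_self, ← LinearEquiv.mul_apply,
        ← map_mul] at this
    rw [← statistics_evolve hD (evolve N Q), ← evolve_mul, inv_mul_cancel_right]

theorem numProtocols_eq {S : Set (BellDiagonal n)} (hS : productStates n ⊆ S) :
    numProtocols n S = Nat.card (Set.range (preBase (n := n))) := by
  rw [numProtocols, ← Nat.card_coe_set_eq]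
  refine Nat.card_congr ((Setoid.quotientKerEquivRange _).symm.trans
    ((Quotient.congrRight fun M N => ?_).trans (Setoid.quotientKerEquivRange _)))
  rw [Setoid.ker_def, Setoid.ker_def, ← statistics_eq_iff hS, funext_iff, Subtype.forall]

theorem mem_distillationSubgroup_iff {D : Sp n} :
    D ∈ distillationSubgroup n ↔ preBase D = preBase 1 := by
  rw [← statistics_eq_iff (Set.subset_univ _)]
  simp only [evolve_one, Set.mem_univ, true_imp_iff]
  rfl

theorem preBase_mul_eq_iff {M N L : Sp n} :
    preBase (M * L) = preBase (N * L) ↔ preBase M = preBase N := by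
  have (M : Sp n) : preBase (M * L) = (preBase M).comap (labelAction n L).toLinearMap := by
    rw [preBase, preBase, ← Submodule.comap_comp, map_mul]
    rfl
  rw [this, this]
  exact (Submodule.comap_injective_of_surjective (labelAction n L).surjective).eq_iff

theorem index_distillationSubgroup_eq :
    (distillationSubgroup n).index = Nat.card (Set.range (preBase (n := n))) := by
  -- The index is defined by left cosets, whereas the fibres of `preBase` are right cosets: left
  -- multiplication by a base-preserving element leaves the preimage unchanged.
  rw [Subgroup.index, ← Nat.card_congr (QuotientGroup.quotientRightRelEquivQuotientLeftRel _)]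
  refine Nat.card_congr
    ((Quotient.congrRight fun M N => ?_).trans (Setoid.quotientKerEquivRange preBase))
  rw [QuotientGroup.rightRel_apply, mem_distillationSubgroup_iff, Setoid.ker_def,
    ← preBase_mul_eq_iff (L := M), inv_mul_cancel_right, one_mul, eq_comm]

end Statistics

/-! ### Counting isotropic subspaces of dimension `n - 1` -/

section Count

variable {m : ℕ}

theorem finrank_binVec (n : ℕ) : finrank (ZMod 2) (BinVec n) = 2 * n := by
  rw [finrank_fintype_fun_eq_card, Fintype.card_sum, Fintype.card_fin, two_mul]

/-- The standard basis of the base. -/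
def baseFrame (m : ℕ) (j : Fin m) : BinVec (m + 1) := Pi.single (Sum.inr j.succ) 1

theorem linearIndependent_baseFrame (m : ℕ) : LinearIndependent (ZMod 2) (baseFrame m) :=
  (Pi.linearIndependent_single_one (Fin (m + 1) ⊕ Fin (m + 1)) (ZMod 2)).comp
    (fun j : Fin m => Sum.inr j.succ) (Sum.inr_injective.comp (Fin.succ_injective m))

theorem span_baseFrame (m : ℕ) :
    Submodule.span (ZMod 2) (Set.range (baseFrame m)) = baseSubmodule (m + 1) := by
  apply le_antisymm
  · rw [Submodule.span_le]
    rintro _ ⟨j, rfl⟩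
    exact single_inr_mem_baseSubmodule (Fin.succ_ne_zero j)
  · intro v hv
    have : v = ∑ j, v (Sum.inr j.succ) • baseFrame m j := by
      funext a
      rw [Finset.sum_apply]
      rcases a with i | i
      · simp [baseFrame, hv.1 i]
      · refine Fin.cases ?_ (fun i => ?_) i
        · simpa [baseFrame, Pi.single_apply, Fin.ext_iff] using hv.2
        · simp [baseFrame, Pi.single_apply]
    rw [this]
    exact Submodule.sum_mem _ fun j _ =>
      Submodule.smul_mem _ _ (Submodule.subset_span ⟨j, rfl⟩)

theorem preBase_inv (M : Sp (m + 1)) :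
    preBase M⁻¹ = Submodule.span (ZMod 2) (Set.range (labelAction (m + 1) M ∘ baseFrame m)) := by
  rw [Set.range_comp]
  erw [← Submodule.map_span (labelAction (m + 1) M).toLinearMap]
  rw [span_baseFrame, preBase, map_inv]
  exact (Submodule.map_equiv_eq_comap_symm (labelAction (m + 1) M) (baseSubmodule (m + 1))).symm

theorem isotropicFrame_labelAction_baseFrame (M : Sp (m + 1)) :
    IsotropicFrame (symplecticForm (m + 1)) (labelAction (m + 1) M ∘ baseFrame m) := by
  refine ⟨(linearIndependent_baseFrame m).map' (labelAction (m + 1) M).toLinearMap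
    (LinearEquiv.ker _), fun i j => ?_⟩
  rw [Function.comp_apply, Function.comp_apply, symplecticForm_labelAction, baseFrame, baseFrame,
    symplecticForm_single_inr]
  simp

/-- The symplectic group acts transitively on the isotropic frames of length `m`. -/
theorem exists_labelAction_comp_baseFrame {s : Fin m → BinVec (m + 1)}
    (hs : IsotropicFrame (symplecticForm (m + 1)) s) :
    ∃ M : Sp (m + 1), labelAction (m + 1) M ∘ baseFrame m = s := by
  have hω := symplecticForm_isAlt (m + 1)
  have hnd := symplecticForm_nondegenerate (m + 1)
  -- A symplectic matrix needs a frame of full length `m + 1`; the extension count `2 ^ (m + 2) - 2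
  -- ^ m` is positive.
  have hpos : 0 < Nat.card {x : BinVec (m + 1) //
      x ∈ (symplecticForm (m + 1)).orthogonal (Submodule.span (ZMod 2) (Set.range s)) ∧
        x ∉ Submodule.span (ZMod 2) (Set.range s)} := by
    rw [card_isotropic_extension hnd hs, Nat.card_zmod, finrank_binVec]
    exact Nat.sub_pos_of_lt (Nat.pow_lt_pow_right one_lt_two (by lia))
  obtain ⟨⟨x, hx⟩⟩ := (Nat.card_pos_iff.1 hpos).1
  have he := (isotropicFrame_snoc_iff hω).2 ⟨hs, hx⟩
  -- The extra vector goes to index `0`, the kept qubit, since `baseFrame` occupies the successor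
  -- indices.
  have he' : IsotropicFrame (symplecticForm (m + 1)) (Fin.cons x s : Fin (m + 1) → _) := by
    have hcons : (Fin.cons x s : Fin (m + 1) → BinVec (m + 1)) =
        (Fin.snoc s x : Fin (m + 1) → BinVec (m + 1)) ∘ (finRotate (m + 1)).symm := by
      funext i
      simp [Fin.snoc_eq_cons_rotate]
    rw [hcons]
    exact ⟨he.1.comp _ (Equiv.injective _), fun i j => he.2 _ _⟩
  obtain ⟨f, hf, hf'⟩ := he'.exists_symplectic_partner hω hnd
  obtain ⟨M, hM⟩ := exists_labelAction_single hf he'.2 hf'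
  exact ⟨M, funext fun j => (hM j.succ).trans (Fin.cons_succ _ _ _)⟩

theorem mem_range_preBase_iff {U : Submodule (ZMod 2) (BinVec (m + 1))} :
    U ∈ Set.range (preBase (n := m + 1)) ↔
      ∃ s : Fin m → BinVec (m + 1), IsotropicFrame (symplecticForm (m + 1)) s ∧
        Submodule.span (ZMod 2) (Set.range s) = U := by
  constructor
  · rintro ⟨M, rfl⟩
    exact ⟨_, isotropicFrame_labelAction_baseFrame M⁻¹, by rw [← preBase_inv, inv_inv]⟩
  · rintro ⟨s, hs, rfl⟩
    obtain ⟨M, rfl⟩ := exists_labelAction_comp_baseFrame hs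
    exact ⟨M⁻¹, preBase_inv M⟩

/-- The isotropic frames that span a given isotropic subspace are its bases. -/
def framesOfSpanEquiv {U : Submodule (ZMod 2) (BinVec (m + 1))}
    (hU : U ∈ Set.range (preBase (n := m + 1))) :
    {s : Fin m → BinVec (m + 1) // IsotropicFrame (symplecticForm (m + 1)) s ∧
      Submodule.span (ZMod 2) (Set.range s) = U} ≃
      {s : Fin m → U // LinearIndependent (ZMod 2) s} where
  toFun s := ⟨fun i => ⟨s.1 i, s.2.2.le (Submodule.subset_span ⟨i, rfl⟩)⟩,
    LinearIndependent.of_comp U.subtype s.2.1.1⟩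
  invFun s := ⟨fun i => s.1 i, by
    have hs : LinearIndependent (ZMod 2) fun i => (s.1 i : BinVec (m + 1)) :=
      s.2.map' U.subtype U.ker_subtype
    obtain ⟨t, ht, rfl⟩ := mem_range_preBase_iff.1 hU
    refine ⟨⟨hs, fun i j => ht.span_le_orthogonal (s.1 j).2 _ (s.1 i).2⟩, ?_⟩
    apply Submodule.eq_of_le_of_finrank_eq
    · rw [Submodule.span_le]
      rintro _ ⟨i, rfl⟩
      exact (s.1 i).2
    · rw [finrank_span_eq_card hs, finrank_span_eq_card ht.1]⟩
  left_inv _ := rfl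
  right_inv _ := rfl

/-- Double counting: each isotropic frame spans one value of `preBase`, and each value is spanned by
as many frames as it has ordered bases. -/
theorem card_range_preBase_mul (m : ℕ) :
    Nat.card (Set.range (preBase (n := m + 1))) * ∏ i ∈ Finset.range m, (2 ^ m - 2 ^ i) =
      ∏ i ∈ Finset.range m, (2 ^ (2 * (m + 1) - i) - 2 ^ i) := by
  have hcard := card_isotropicFrame (symplecticForm_isAlt (m + 1))
    (symplecticForm_nondegenerate (m + 1)) m
  rw [Nat.card_zmod, finrank_binVec] at hcard
  rw [← hcard]
  let Φ (s : {s : Fin m → BinVec (m + 1) // IsotropicFrame (symplecticForm (m + 1)) s}) :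
      Set.range (preBase (n := m + 1)) :=
    ⟨Submodule.span (ZMod 2) (Set.range s.1), mem_range_preBase_iff.2 ⟨s.1, s.2, rfl⟩⟩
  have hfib (U : Set.range (preBase (n := m + 1))) :
      Nat.card {s // Φ s = U} = ∏ i ∈ Finset.range m, (2 ^ m - 2 ^ i) := by
    have hU : finrank (ZMod 2) U.1 = m := by
      obtain ⟨t, ht, h⟩ := mem_range_preBase_iff.1 U.2
      rw [← h, finrank_span_eq_card ht.1, Fintype.card_fin]
    have h := card_linearIndependent (K := ZMod 2) (V := U.1) (k := m) hU.ge
    rw [← Nat.card_congr (framesOfSpanEquiv U.2), hU, ZMod.card,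
      Fin.prod_univ_eq_prod_range (fun i => 2 ^ m - 2 ^ i) m] at h
    rw [← h]
    refine Nat.card_congr ((Equiv.subtypeEquivRight fun s => ?_).trans
      (Equiv.subtypeSubtypeEquivSubtypeInter _
        fun s => Submodule.span (ZMod 2) (Set.range s) = U.1))
    exact Subtype.ext_iff
  have : Fintype (Set.range (preBase (n := m + 1))) := Fintype.ofFinite _
  rw [← Nat.card_congr (Equiv.sigmaFiberEquiv Φ), Nat.card_sigma,
    Finset.sum_congr rfl fun U _ => hfib U, Finset.sum_const, Finset.card_univ,
    ← Nat.card_eq_fintype_card, smul_eq_mul]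

/-- Each factor splits as `4 ^ j - 1 = (2 ^ j - 1) * (2 ^ j + 1)`. Here `j` starts at `2`, so `1 /
3` compensates for the factor `2 ^ 1 + 1`. -/
theorem prod_four_pow_sub_one (m : ℕ) :
    ∏ j ∈ Finset.range m, ((4 : ℚ) ^ (j + 2) - 1) =
      1 / 3 * (2 ^ (m + 1) - 1) * (∏ j ∈ Finset.Icc 1 (m + 1), (2 ^ j + 1)) *
        ∏ j ∈ Finset.range m, (2 ^ (j + 1) - 1) := by
  induction m with
  | zero => norm_num
  | succ m ih =>
    rw [Finset.prod_range_succ, ih, Finset.prod_Icc_succ_top (by lia : 1 ≤ m + 1 + 1),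
      Finset.prod_range_succ]
    have h4 : (4 : ℚ) ^ (m + 2) = 2 ^ (m + 2) * 2 ^ (m + 2) := by
      rw [← mul_pow]
      norm_num
    rw [h4]
    ring

theorem card_range_preBase (m : ℕ) :
    (Nat.card (Set.range (preBase (n := m + 1))) : ℚ) =
      1 / 3 * (2 ^ (m + 1) - 1) * ∏ j ∈ Finset.Icc 1 (m + 1), (2 ^ j + 1) := by
  have h := congrArg (Nat.cast (R := ℚ)) (card_range_preBase_mul m)
  push_cast at h
  have h1 : ∏ i ∈ Finset.range m, (((2 ^ m - 2 ^ i : ℕ)) : ℚ) =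
      (∏ i ∈ Finset.range m, 2 ^ i) * ∏ j ∈ Finset.range m, (2 ^ (j + 1) - 1) := by
    -- Pull `2 ^ i` out of each factor and reverse the order; the same powers of 2 come out of the
    -- frame count below and cancel.
    rw [← Finset.prod_range_reflect (fun j => (2 : ℚ) ^ (j + 1) - 1), ← Finset.prod_mul_distrib]
    refine Finset.prod_congr rfl fun i hi => ?_
    have hi := Finset.mem_range.1 hi
    rw [Nat.cast_sub (Nat.pow_le_pow_right two_pos hi.le), mul_sub, ← pow_add, mul_one]
    push_cast
    congr 2
    lia
  have h2 : ∏ i ∈ Finset.range m, (((2 ^ (2 * (m + 1) - i) - 2 ^ i : ℕ)) : ℚ) =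
      (∏ i ∈ Finset.range m, 2 ^ i) * ∏ j ∈ Finset.range m, (4 ^ (j + 2) - 1) := by
    rw [← Finset.prod_range_reflect (fun j => (4 : ℚ) ^ (j + 2) - 1), ← Finset.prod_mul_distrib]
    refine Finset.prod_congr rfl fun i hi => ?_
    have hi := Finset.mem_range.1 hi
    rw [Nat.cast_sub (Nat.pow_le_pow_right two_pos (by lia)), mul_sub,
      show (4 : ℚ) = 2 ^ 2 by norm_num, ← pow_mul, ← pow_add, mul_one]
    push_cast
    congr 2
    lia
  have h3 : (∏ i ∈ Finset.range m, (2 : ℚ) ^ i) ≠ 0 :=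
    Finset.prod_ne_zero_iff.2 fun i _ => by positivity
  have h4 : ∏ j ∈ Finset.range m, ((2 : ℚ) ^ (j + 1) - 1) ≠ 0 :=
    Finset.prod_ne_zero_iff.2 fun j _ =>
      (sub_pos.2 (one_lt_pow₀ one_lt_two (Nat.succ_ne_zero j))).ne'
  rw [h1, h2, prod_four_pow_sub_one] at h
  apply mul_right_cancel₀ (mul_ne_zero h3 h4)
  rw [h]
  ring

end Count

end BilocalClifford

theorem mainTheorem2 (n : ℕ) [NeZero n] :
    ((BilocalClifford.distillationSubgroup n).index : ℚ) =
        1 / 3 * (2 ^ n - 1) * ∏ j ∈ Finset.Icc 1 n, (2 ^ j + 1) ∧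
      (BilocalClifford.numProtocols n Set.univ : ℚ) =
        1 / 3 * (2 ^ n - 1) * ∏ j ∈ Finset.Icc 1 n, (2 ^ j + 1) ∧
      (BilocalClifford.numProtocols n (BilocalClifford.productStates n) : ℚ) =
        1 / 3 * (2 ^ n - 1) * ∏ j ∈ Finset.Icc 1 n, (2 ^ j + 1) := by
  rw [BilocalClifford.index_distillationSubgroup_eq,
    BilocalClifford.numProtocols_eq (Set.subset_univ _),
    BilocalClifford.numProtocols_eq subset_rfl, and_self, and_self]
  obtain ⟨m, rfl⟩ := Nat.exists_eq_succ_of_ne_zero (NeZero.ne n)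
  exact BilocalClifford.card_range_preBase m
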